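/- Let $N\ge 2$ and $d\ge 1$ be integers, let $\mathcal A=(a_{j_1,\dots,j_N})\in\mathbb R^{d\times\cdots\times d}$ be a real tensor of order $N$ all of whose modes have size $d$, and let $g^{(1)},\dots,g^{(N-1)}\in\mathbb R^d$ be random vectors all of whose $(N-1)d$ entries are i.i.d. $\mathcal N(0,1)$. Let $\bar\times_n$ denote summation of the $n$-th index of a tensor against a vector, let $*$ denote the entrywise product of vectors, and put $$y:=\big(g^{(1)}*\cdots*g^{(N-1)}\big)*\big(\mathcal A\,\bar\times_1 g^{(1)}\,\bar\times_2 g^{(2)}\cdots\bar\times_{N-1}g^{(N-1)}\big)\in\mathbb R^d ,$$ that is, $y_i=\Big(\prod_{t=1}^{N-1}g^{(t)}_i\Big)\sum_{j_1,\dots,j_{N-1}=1}^d a_{j_1,\dots,j_{N-1},i}\prod_{t=1}^{N-1}g^{(t)}_{j_t}$. (1) For every $i\in\{1,\dots,d\}$, $y_i$ has a finite second moment and $$\mathrm{Var}(y_i)=\sum_{s=0}^{N-1}3^s\Bigg(\sum_{\substack{(j_1,\dots,j_{N-1})\\ \#\{t:\,j_t=i\}=s}}a_{j_1,\dots,j_{N-1},i}^2\Bigg)-a_{i,\dots,i}^2\;\le\;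 V_i ,$$ where $$V_i:=(3^{N-1}-1)\,a_{i,\dots,i}^2+3^{N-2}\sum_{(j_1,\dots,j_{N-1})\ne(i,\dots,i)}a_{j_1,\dots,j_{N-1},i}^2 .$$ (2) There is an absolute constant $C>0$ (independent of $N,d,\mathcal A,i,\epsilon,\delta$) such that, for all $N$, $d$, $\mathcal A$ as above, every $i$ with $a_{i,\dots,i}\neq0$, all $\epsilon>0$ and $\delta\in(0,1)$, and every integer $$K\;\ge\; C\,\frac{V_i\,\big(2+\log(1/\delta)\big)^{2(N-1)}}{\epsilon^2\,a_{i,\dots,i}^2},$$ the average $Y=\frac1K\sum_{k=1}^K y_i^{(k)}$ of $K$ estimates, computed from $K$ independent copies of $(g^{(1)},\dots,g^{(N-1)})$, is an $(\epsilon,\delta)$-approximation of $a_{i,\dots,i}$: $$\Pr\big(|Y-a_{i,\dots,i}|\le\epsilon\,|a_{i,\dots,i}|\big)\ge 1-\delta .$$ -/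

import Mathlib

open MeasureTheory ProbabilityTheory Finset

namespace TensorDiag

/-- Real tensors of order `N` all of whose modes have size `d`. -/
abbrev Tensor (N d : ℕ) : Type := (Fin N → Fin d) → ℝ

/-- Mode-`p` tensor-vector multiplication: sum the `p`-th index of `A` against `x`.
The result is a tensor of order one less. -/
def modeMul {N d : ℕ} (A : Tensor (N + 1) d) (p : Fin (N + 1)) (x : Fin d → ℝ) : Tensor N d :=
  fun idx => ∑ j : Fin d, A (p.insertNth j idx) * x j

/-- The vector obtained from a tensor of order `m + 1` by multiplying its first mode by `g 0`,
its second mode by `g 1`, ..., its `m`-th mode by `g (m - 1)`, in this order. After each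
multiplication the next mode to be treated is the first one of the remaining tensor. -/
def contract {d : ℕ} : {m : ℕ} → Tensor (m + 1) d → (Fin m → Fin d → ℝ) → Fin d → ℝ
  | 0, A, _ => fun i => A (fun _ => i)
  | _ + 1, A, g => contract (modeMul A 0 (g 0)) (fun t => g t.succ)

/-- The diagonal estimator `y = g * (A ×₁ g⁽¹⁾ ×₂ ⋯ ×ₘ g⁽ᵐ⁾)`, where `g = g⁽¹⁾ * ⋯ * g⁽ᵐ⁾` and
`*` is the entrywise product of vectors. -/
def diagEstimator {m d : ℕ} (A : Tensor (m + 1) d) (g : Fin m → Fin d → ℝ) : Fin d → ℝ :=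
  (∏ t, g t) * contract A g

/-- The diagonal entry `a_{i,…,i}`. -/
def diagEntry {N d : ℕ} (A : Tensor N d) (i : Fin d) : ℝ := A (fun _ => i)

/-- The entry `a_{j₁,…,jₘ,i}`. -/
def entry {m d : ℕ} (A : Tensor (m + 1) d) (j : Fin m → Fin d) (i : Fin d) : ℝ :=
  A (Fin.snoc (α := fun _ => Fin d) j i)

/-- The sum of the squares of the entries `a_{j₁,…,jₘ,i}` with `(j₁,…,jₘ) ≠ (i,…,i)`. -/
def offDiagSq {m d : ℕ} (A : Tensor (m + 1) d) (i : Fin d) : ℝ :=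
  ∑ j : Fin m → Fin d with j ≠ (fun _ => i), entry A j i ^ 2

/-- The sum of the squares of the entries `a_{j₁,…,jₘ,i}` for which exactly `s` of the indices
`j₁,…,jₘ` are equal to `i`. -/
def levelSq {m d : ℕ} (A : Tensor (m + 1) d) (i : Fin d) (s : ℕ) : ℝ :=
  ∑ j : Fin m → Fin d with #{t : Fin m | j t = i} = s, entry A j i ^ 2

/-- The crude variance bound `(3ᵐ - 1) a_{i,…,i}² + 3ᵐ⁻¹ ∑ a_{j₁,…,jₘ,i}²`, the sum being over
`(j₁,…,jₘ) ≠ (i,…,i)`, for a tensor of order `m + 1` with `m ≥ 1`. -/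
def varBound {m d : ℕ} (A : Tensor (m + 1) d) (i : Fin d) : ℝ :=
  (3 ^ m - 1) * diagEntry A i ^ 2 + 3 ^ (m - 1) * offDiagSq A i

/-- The random variables `X k` are independent (jointly) with distribution `N(0,1)`. -/
def IsIIDStdNormal {Ω ι : Type*} [MeasurableSpace Ω] (X : ι → Ω → ℝ) (μ : Measure Ω) : Prop :=
  iIndepFun X μ ∧ ∀ k, HasLaw (X k) (gaussianReal 0 1) μ

/-- `X` is an `(ε, δ)`-approximation of `ξ`: the relative error is at most `ε` with probability
at least `1 - δ`. -/
def IsApproximation {Ω : Type*} [MeasurableSpace Ω] (X : Ω → ℝ) (μ : Measure Ω)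
    (ε δ ξ : ℝ) : Prop :=
  1 - δ ≤ μ.real {ω | |X ω - ξ| ≤ ε * |ξ|}

end TensorDiag

/-! Multiplied out, y_i = ∑_j a_{j,i} ∏_t g_i^(t) g_{j_t}^(t). For one standard Gaussian vector x,
the products x_i x_j (i fixed) are orthogonal in L², with mean δ_ij and squared norm 3 if j = i, 1
otherwise. Taking products over the independent blocks t, y_i has mean a_{i,…,i}, and the entry with
s indices equal to i contributes 3^s a² to the second moment. Off the diagonal s ≤ N - 2, whence
V_i.

Chebyshev's inequality would cost a factor 1/δ in K, so (2) uses Markov's inequality for a moment of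
order 2k with k of size log(1/δ). In the centred basis 1, x_i x_j - δ_ij of one block, the 2k-th
moment is at most (∑ w b²)^k, where w is 1 on the constant and 256 k² times the squared norm
elsewhere (`isHypercontractive_blockVar`). Minkowski's inequality carries this to products
(`IsHypercontractive.prod`). Since the constant has weight 1, a combination of basis products
involving at most N - 1 blocks each loses only (256 k²)^(N-1) against its L² norm, whatever K is
(`integral_pow_le_of_mem_chaos`). Y - a_{i,…,i} is such a combination, with second moment at most
V_i / K. For L = 2 + log(1/δ), a k with 16 k ≤ L and 32 k ≥ L - 2 (or simply k = 1) makes the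
failure probability at most e^(-32 k) ≤ δ, with C = e^32. -/

namespace TensorDiag

/-! ### Functions with finite moments of all orders -/

/-- All moments of the function `f` are finite. -/
def HasAllMoments {Ω : Type*} [MeasurableSpace Ω] (f : Ω → ℝ) (μ : Measure Ω) : Prop :=
  ∀ n : ℕ, MemLp f n μ

namespace HasAllMoments

variable {Ω : Type*} [MeasurableSpace Ω] {μ : Measure Ω} {f g : Ω → ℝ}

theorem const [IsFiniteMeasure μ] (c : ℝ) : HasAllMoments (fun _ : Ω => c) μ :=
  fun _ => memLp_const c

theorem add (hf : HasAllMoments f μ) (hg : HasAllMoments g μ) :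
    HasAllMoments (fun ω => f ω + g ω) μ :=
  fun n => (hf n).add (hg n)

theorem mul (hf : HasAllMoments f μ) (hg : HasAllMoments g μ) :
    HasAllMoments (fun ω => f ω * g ω) μ := by
  intro n
  -- Cauchy–Schwarz: a product lies in Lⁿ when both factors lie in L²ⁿ.
  have : ENNReal.HolderTriple ((2 * n : ℕ) : ENNReal) ((2 * n : ℕ) : ENNReal) (n : ENNReal) := by
    constructor
    rcases eq_or_ne n 0 with rfl | hn
    · simp
    · push_cast
      rw [ENNReal.mul_inv (by simp) (by simp), ← add_mul, ENNReal.inv_two_add_inv_two, one_mul]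
  exact (hg (2 * n)).mul (hf (2 * n))

theorem const_mul [IsFiniteMeasure μ] (c : ℝ) (hf : HasAllMoments f μ) :
    HasAllMoments (fun ω => c * f ω) μ :=
  (const c).mul hf

theorem sub [IsFiniteMeasure μ] (hf : HasAllMoments f μ) (hg : HasAllMoments g μ) :
    HasAllMoments (fun ω => f ω - g ω) μ :=
  fun n => (hf n).sub (hg n)

theorem pow [IsFiniteMeasure μ] (hf : HasAllMoments f μ) (n : ℕ) :
    HasAllMoments (fun ω => f ω ^ n) μ := by
  induction n with
  | zero => simpa using const (μ := μ) 1
  | succ n ih => simpa only [pow_succ] using ih.mul hf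

theorem finsetSum {ι : Type*} [IsFiniteMeasure μ] (s : Finset ι) {F : ι → Ω → ℝ}
    (hF : ∀ i ∈ s, HasAllMoments (F i) μ) : HasAllMoments (fun ω => ∑ i ∈ s, F i ω) μ :=
  fun n => memLp_finsetSum s fun i hi => hF i hi n

theorem finsetProd {ι : Type*} [IsFiniteMeasure μ] (s : Finset ι) {F : ι → Ω → ℝ}
    (hF : ∀ i ∈ s, HasAllMoments (F i) μ) : HasAllMoments (fun ω => ∏ i ∈ s, F i ω) μ := by
  classical
  induction s using Finset.induction_on with
  | empty => simpa using const (μ := μ) 1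
  | insert a s ha ih =>
    simp only [prod_insert ha]
    exact (hF a (mem_insert_self a s)).mul (ih fun i hi => hF i (mem_insert_of_mem hi))

theorem integrable (hf : HasAllMoments f μ) : Integrable f μ :=
  memLp_one_iff_integrable.1 (by simpa using hf 1)

theorem integrable_pow [IsFiniteMeasure μ] (hf : HasAllMoments f μ) (n : ℕ) :
    Integrable (fun ω => f ω ^ n) μ :=
  (hf.pow n).integrable

theorem comp_measurePreserving {Ω' : Type*} [MeasurableSpace Ω'] {μ' : Measure Ω'} {φ : Ω' → Ω}
    (hf : HasAllMoments f μ) (hφ : MeasurePreserving φ μ' μ) :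
    HasAllMoments (fun ω => f (φ ω)) μ' :=
  fun n => (hf n).comp_measurePreserving hφ

end HasAllMoments

/-! ### Moments of a constant plus a centred variable -/

/-- The graph of an even power lies above its tangent lines. -/
theorem tangent_le_even_pow (k : ℕ) (c h : ℝ) :
    c ^ (2 * k) + 2 * k * c ^ (2 * k - 1) * h ≤ (c + h) ^ (2 * k) := by
  rcases k.eq_zero_or_pos with rfl | hk
  · simp
  have hconv : ConvexOn ℝ Set.univ fun x : ℝ => x ^ (2 * k) := (even_two_mul k).convexOn_pow
  have hd : HasDerivAt (fun x : ℝ => x ^ (2 * k)) (((2 * k : ℕ) : ℝ) * c ^ (2 * k - 1)) c :=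
    hasDerivAt_pow _ _
  rcases lt_trichotomy h 0 with hh | rfl | hh
  · have h1 := hconv.slope_le_of_hasDerivAt (x := c + h) (y := c) (by simp) (by simp) (by linarith) hd
    rw [slope_def_field, div_le_iff₀ (by linarith)] at h1
    push_cast at h1
    linarith
  · simp
  · have h1 := hconv.le_slope_of_hasDerivAt (x := c) (y := c + h) (by simp) (by simp) (by linarith) hd
    rw [slope_def_field, le_div_iff₀ (by linarith)] at h1
    push_cast at h1
    linarith

/-- Convexity at c + q, the midpoint of c + 2q and c, followed by the tangent at c evaluated at c -
2q. The right side is even in q up to a linear term, which integrates to zero for centred q, so odd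
moments never need a bound. -/
theorem even_pow_add_le_symm (k : ℕ) (c q : ℝ) :
    (c + q) ^ (2 * k) ≤
      ((c + 2 * q) ^ (2 * k) + (c - 2 * q) ^ (2 * k)) / 2 + 2 * k * c ^ (2 * k - 1) * q := by
  have h1 := tangent_le_even_pow k c (-(2 * q))
  have hconv : ConvexOn ℝ Set.univ fun x : ℝ => x ^ (2 * k) := (even_two_mul k).convexOn_pow
  have h2 := hconv.2 (Set.mem_univ (c + 2 * q)) (Set.mem_univ c)
    (by norm_num : (0 : ℝ) ≤ 1 / 2) (by norm_num : (0 : ℝ) ≤ 1 / 2) (by norm_num)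
  simp only [smul_eq_mul] at h2
  have h3 : 1 / 2 * (c + 2 * q) + 1 / 2 * c = c + q := by ring
  rw [h3] at h2
  rw [← sub_eq_add_neg] at h1
  linarith

theorem even_pow_symm_eq_sum (k : ℕ) (c r : ℝ) :
    ((c + r) ^ (2 * k) + (c - r) ^ (2 * k)) / 2 =
      ∑ j ∈ range (k + 1), ((2 * k).choose (2 * j) : ℝ) * (c ^ 2) ^ (k - j) * r ^ (2 * j) := by
  have key : ∀ f : ℕ → ℝ, ∑ n ∈ range (2 * k + 1), (f n + (-1) ^ n * f n) / 2 =
      ∑ j ∈ range (k + 1), f (2 * j) := by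
    intro f
    induction k with
    | zero => simp
    | succ k ih =>
      rw [show 2 * (k + 1) + 1 = 2 * k + 1 + 1 + 1 by ring, sum_range_succ, sum_range_succ, ih,
        sum_range_succ _ (k + 1)]
      have h1 : (-1 : ℝ) ^ (2 * k + 1) = -1 := by rw [pow_succ, pow_mul]; norm_num
      have h2 : (-1 : ℝ) ^ (2 * k + 1 + 1) = 1 := by rw [pow_succ, h1]; norm_num
      rw [h1, h2, show 2 * (k + 1) = 2 * k + 1 + 1 by ring]
      ring
  have h := key fun n => r ^ n * c ^ (2 * k - n) * ((2 * k).choose n : ℝ)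
  rw [add_comm c r, sub_eq_add_neg, add_comm c (-r), add_pow, add_pow, ← sum_add_distrib, sum_div]
  refine Eq.trans (sum_congr rfl fun n _ => ?_) (h.trans (sum_congr rfl fun j hj => ?_))
  · rw [neg_pow r n]; ring
  · rw [← pow_mul, show 2 * (k - j) = 2 * k - 2 * j by omega]; ring

theorem choose_two_mul_mul_factorial_le (k j : ℕ) :
    ((2 * k).choose (2 * j) : ℝ) * ((2 * j).factorial : ℝ) ≤ (4 * (k : ℝ) ^ 2) ^ j := by
  have h1 : (2 * k).choose (2 * j) * (2 * j).factorial ≤ (2 * k) ^ (2 * j) := by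
    rw [mul_comm, ← Nat.descFactorial_eq_factorial_mul_choose]
    exact Nat.descFactorial_le_pow _ _
  calc _ ≤ (((2 * k) ^ (2 * j) : ℕ) : ℝ) := by exact_mod_cast h1
    _ = _ := by push_cast; rw [pow_mul]; ring

/-- A centred variable with factorially growing even moments is hypercontractive after adding a
constant. -/
theorem integral_const_add_pow_le {Ω : Type*} [MeasurableSpace Ω] {μ : Measure Ω}
    [IsProbabilityMeasure μ] {Q : Ω → ℝ} (hQ : HasAllMoments Q μ) (hmean : ∫ ω, Q ω ∂μ = 0)
    {D σ : ℝ} (hD : 0 ≤ D) (hσ : 0 ≤ σ)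
    (hmom : ∀ j : ℕ, 1 ≤ j → ∫ ω, Q ω ^ (2 * j) ∂μ ≤ D ^ j * (2 * j).factorial * σ ^ j)
    (k : ℕ) (c : ℝ) :
    ∫ ω, (c + Q ω) ^ (2 * k) ∂μ ≤ (c ^ 2 + 16 * D * k ^ 2 * σ) ^ k := by
  have hint : ∀ j, Integrable (fun ω => ((2 * k).choose (2 * j) : ℝ) * (c ^ 2) ^ (k - j) *
      (2 * Q ω) ^ (2 * j)) μ := fun j => ((hQ.const_mul 2).integrable_pow _).const_mul _
  calc ∫ ω, (c + Q ω) ^ (2 * k) ∂μ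
      ≤ ∫ ω, (∑ j ∈ range (k + 1), ((2 * k).choose (2 * j) : ℝ) * (c ^ 2) ^ (k - j) *
          (2 * Q ω) ^ (2 * j)) + 2 * k * c ^ (2 * k - 1) * Q ω ∂μ := by
        refine integral_mono (((HasAllMoments.const c).add hQ).integrable_pow _)
          ((integrable_finsetSum _ fun j _ => hint j).add (hQ.integrable.const_mul _)) fun ω => ?_
        simpa only [even_pow_symm_eq_sum] using even_pow_add_le_symm k c (Q ω)
    _ = ∑ j ∈ range (k + 1), ((2 * k).choose (2 * j) : ℝ) * (c ^ 2) ^ (k - j) *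
          (4 ^ j * ∫ ω, Q ω ^ (2 * j) ∂μ) := by
        rw [integral_add (integrable_finsetSum _ fun j _ => hint j) (hQ.integrable.const_mul _),
          integral_const_mul, hmean, mul_zero, add_zero, integral_finsetSum _ fun j _ => hint j]
        refine sum_congr rfl fun j _ => ?_
        rw [integral_const_mul]
        simp only [mul_pow]
        rw [integral_const_mul, pow_mul]
        norm_num
    -- The factorial in the moment bound is absorbed by the binomial coefficient at the cost of (4
    -- k²)^j. Inserting `k.choose j`, which is at least 1, turns the sum into a binomial expansion.
    _ ≤ ∑ j ∈ range (k + 1), (16 * D * k ^ 2 * σ) ^ j * (c ^ 2) ^ (k - j) * (k.choose j : ℝ) := by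
        refine sum_le_sum fun j hj => ?_
        have hjk : j ≤ k := by simpa [Nat.lt_succ_iff] using hj
        rcases j.eq_zero_or_pos with rfl | hj0
        · simp
        have hch : (1 : ℝ) ≤ k.choose j := by exact_mod_cast Nat.choose_pos hjk
        calc ((2 * k).choose (2 * j) : ℝ) * (c ^ 2) ^ (k - j) * (4 ^ j * ∫ ω, Q ω ^ (2 * j) ∂μ)
            ≤ ((2 * k).choose (2 * j) : ℝ) * (c ^ 2) ^ (k - j) *
              (4 ^ j * (D ^ j * (2 * j).factorial * σ ^ j)) := by
              have := hmom j hj0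
              gcongr
          _ = ((2 * k).choose (2 * j) * (2 * j).factorial) *
                (4 ^ j * D ^ j * σ ^ j * (c ^ 2) ^ (k - j)) := by ring
          _ ≤ (4 * (k : ℝ) ^ 2) ^ j * (4 ^ j * D ^ j * σ ^ j * (c ^ 2) ^ (k - j)) := by
              have := choose_two_mul_mul_factorial_le k j
              gcongr
          _ = (16 * D * k ^ 2 * σ) ^ j * (c ^ 2) ^ (k - j) := by
              rw [show 16 * D * (k : ℝ) ^ 2 * σ = (4 * (k : ℝ) ^ 2) * (4 * D * σ) by ring,
                mul_pow, mul_pow, mul_pow]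
              ring
          _ ≤ _ := le_mul_of_one_le_right (by positivity) hch
    _ = _ := by rw [add_comm (c ^ 2), add_pow]

/-! ### Gaussian moments in one and several dimensions -/

theorem hasAllMoments_id_gaussianReal (v : NNReal) :
    HasAllMoments (fun x : ℝ => x) (gaussianReal 0 v) :=
  fun n => memLp_id_gaussianReal' _ (by simp)

/-- By evenness this is twice an integral over the half-line, which is a Gamma integral; the
recursion of the moments is then that of Γ. -/
theorem integral_pow_two_mul_gaussianReal (n : ℕ) :
    ∫ x, x ^ (2 * n) ∂gaussianReal 0 1 = 2 ^ n * Real.Gamma (n + 1 / 2) / √Real.pi := by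
  rw [integral_gaussianReal_eq_integral_smul one_ne_zero]
  obtain ⟨F, hF⟩ : ∃ F : ℝ → ℝ,
      F = fun y => y ^ ((2 * n : ℕ) : ℝ) * Real.exp (-(1 / 2) * y ^ (2 : ℝ)) := ⟨_, rfl⟩
  have h1 : ∀ x : ℝ, gaussianPDFReal 0 1 x • x ^ (2 * n) = (√(2 * Real.pi))⁻¹ * F |x| := by
    intro x
    simp only [hF, gaussianPDFReal_def, smul_eq_mul, sub_zero, NNReal.coe_one, mul_one,
      Real.rpow_natCast, Real.rpow_two, sq_abs, pow_mul]
    rw [show -x ^ 2 / 2 = -(1 / 2) * x ^ 2 by ring]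
    ring
  simp only [h1]
  rw [integral_const_mul, integral_comp_abs, hF,
    integral_rpow_mul_exp_neg_mul_rpow (by norm_num)
      (lt_of_lt_of_le (by norm_num) (Nat.cast_nonneg _)) (by norm_num)]
  have h2 : (((2 * n : ℕ) : ℝ) + 1) / 2 = n + 1 / 2 := by push_cast; ring
  have h3 : -(((2 * n : ℕ) : ℝ) + 1) / 2 = -(n + 1 / 2) := by push_cast; ring
  rw [h2, h3, Real.rpow_neg (by norm_num), Real.rpow_add (by norm_num), Real.rpow_natCast,
    ← Real.sqrt_eq_rpow, Real.sqrt_mul (by norm_num), Real.sqrt_div (by norm_num)]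
  have h4 : √(2 : ℝ) ≠ 0 := by positivity
  have h5 : √Real.pi ≠ 0 := by positivity
  rw [one_div_pow, Real.sqrt_one]
  field_simp

theorem integral_pow_two_mul_succ_gaussianReal (n : ℕ) :
    ∫ x, x ^ (2 * (n + 1)) ∂gaussianReal 0 1 =
      (2 * n + 1) * ∫ x, x ^ (2 * n) ∂gaussianReal 0 1 := by
  rw [integral_pow_two_mul_gaussianReal, integral_pow_two_mul_gaussianReal,
    show ((n + 1 : ℕ) : ℝ) + 1 / 2 = (n + 1 / 2) + 1 by push_cast; ring,
    Real.Gamma_add_one (by positivity), pow_succ]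
  ring

theorem integral_pow_two_gaussianReal : ∫ x, x ^ 2 ∂gaussianReal 0 1 = 1 := by
  simpa using integral_pow_two_mul_succ_gaussianReal 0

theorem integral_pow_four_gaussianReal : ∫ x, x ^ 4 ∂gaussianReal 0 1 = 3 := by
  have h := integral_pow_two_mul_succ_gaussianReal 1
  norm_num [integral_pow_two_gaussianReal] at h
  exact h

theorem integral_odd_pow_gaussianReal {n : ℕ} (hn : Odd n) :
    ∫ x, x ^ n ∂gaussianReal 0 1 = 0 := by
  have h : ∫ x, x ^ n ∂gaussianReal 0 1 = ∫ x, (-x) ^ n ∂gaussianReal 0 1 := by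
    conv_lhs => rw [← neg_zero, ← gaussianReal_map_neg]
    rw [integral_map (by fun_prop) (by fun_prop)]
  simp only [hn.neg_pow, integral_neg] at h
  linarith

theorem one_le_integral_pow_two_mul_gaussianReal (n : ℕ) :
    1 ≤ ∫ x, x ^ (2 * n) ∂gaussianReal 0 1 := by
  induction n with
  | zero => simp
  | succ n ih =>
    rw [integral_pow_two_mul_succ_gaussianReal]
    nlinarith [(Nat.cast_nonneg n : (0 : ℝ) ≤ n)]

theorem integral_pow_two_mul_gaussianReal_le (n : ℕ) :
    ∫ x, x ^ (2 * n) ∂gaussianReal 0 1 ≤ 2 ^ n * n.factorial := by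
  induction n with
  | zero => simp
  | succ n ih =>
    rw [integral_pow_two_mul_succ_gaussianReal, Nat.factorial_succ, pow_succ]
    push_cast
    calc (2 * (n : ℝ) + 1) * ∫ x, x ^ (2 * n) ∂gaussianReal 0 1
        ≤ (2 * (n : ℝ) + 2) * (2 ^ n * n.factorial) := by
          have h0 := one_le_integral_pow_two_mul_gaussianReal n
          gcongr
          norm_num
      _ = _ := by ring

/-- The standard Gaussian measure on `ℝᵈ`. -/
noncomputable abbrev stdGauss (d : ℕ) : Measure (Fin d → ℝ) := Measure.pi fun _ => gaussianReal 0 1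

theorem hasAllMoments_eval {d : ℕ} (j : Fin d) : HasAllMoments (fun x => x j) (stdGauss d) :=
  (hasAllMoments_id_gaussianReal 1).comp_measurePreserving (measurePreserving_eval _ j)

theorem integral_prod_pow_stdGauss {d : ℕ} (n : Fin d → ℕ) :
    ∫ x, ∏ p, x p ^ n p ∂stdGauss d = ∏ p, ∫ x, x ^ n p ∂gaussianReal 0 1 :=
  integral_fintype_prod_eq_prod fun p (x : ℝ) => x ^ n p

theorem integral_mul_stdGauss {d : ℕ} (i j : Fin d) :
    ∫ x, x i * x j ∂stdGauss d = if j = i then 1 else 0 := by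
  have h : ∀ x : Fin d → ℝ, x i * x j =
      ∏ p, x p ^ ((if p = i then 1 else 0) + (if p = j then 1 else 0)) := by
    intro x
    simp only [pow_add, prod_mul_distrib, pow_ite, pow_zero, pow_one, prod_ite_eq', mem_univ,
      if_true]
  simp only [h, integral_prod_pow_stdGauss]
  split_ifs with hij
  · subst hij
    refine prod_eq_one fun p _ => ?_
    split_ifs <;> simp [integral_pow_two_gaussianReal]
  · refine prod_eq_zero (mem_univ j) (integral_odd_pow_gaussianReal ?_)
    simp [hij]

theorem integral_mul_mul_mul_stdGauss {d : ℕ} (i j l : Fin d) :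
    ∫ x, (x i * x j) * (x i * x l) ∂stdGauss d =
      if j = l then (if j = i then 3 else 1) else 0 := by
  have h : ∀ x : Fin d → ℝ, (x i * x j) * (x i * x l) =
      ∏ p, x p ^ ((if p = i then 2 else 0) + (if p = j then 1 else 0)
        + (if p = l then 1 else 0)) := by
    intro x
    simp only [pow_add, prod_mul_distrib, pow_ite, pow_zero, pow_one, prod_ite_eq', mem_univ,
      if_true]
    ring
  simp only [h, integral_prod_pow_stdGauss]
  split_ifs with hjl hji
  · subst hjl hji
    rw [prod_eq_single j]
    · simp [integral_pow_four_gaussianReal]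
    · intro p _ hp; simp [hp]
    · simp
  · subst hjl
    refine prod_eq_one fun p _ => ?_
    split_ifs with h1 h2 h2
    · exact absurd (h2.symm.trans h1) hji
    all_goals simp [integral_pow_two_gaussianReal]
  · by_cases hji : j = i
    · refine prod_eq_zero (mem_univ l) (integral_odd_pow_gaussianReal ?_)
      have : l ≠ i := fun h => hjl (hji.trans h.symm)
      simp [this, Ne.symm hjl]
    · refine prod_eq_zero (mem_univ j) (integral_odd_pow_gaussianReal ?_)
      simp [hji, hjl]

theorem map_sum_mul_stdGauss {d : ℕ} (b : Fin d → ℝ) :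
    (stdGauss d).map (fun x => ∑ j, b j * x j) = gaussianReal 0 (∑ j, b j ^ 2).toNNReal := by
  have hind : iIndepFun (fun (j : Fin d) (x : Fin d → ℝ) => b j * x j) (stdGauss d) :=
    iIndepFun_pi (X := fun j (y : ℝ) => b j * y) fun j => by fun_prop
  have hlaw : ∀ j : Fin d, HasLaw (fun x : Fin d → ℝ => x j) (gaussianReal 0 1) (stdGauss d) :=
    fun j => (measurePreserving_eval (fun _ => gaussianReal 0 1) j).hasLaw
  have hg : HasGaussianLaw (fun x : Fin d → ℝ => ∑ j, b j * x j) (stdGauss d) :=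
    hind.hasGaussianLaw_fun_sum fun j => (gaussianReal_const_mul (hlaw j) (b j)).hasGaussianLaw
  rw [hg.map_eq_gaussianReal]
  congr 1
  · rw [integral_finsetSum _ fun j _ => ((hasAllMoments_eval j).const_mul _).integrable]
    refine sum_eq_zero fun j _ => ?_
    rw [integral_const_mul, (hlaw j).integral_eq]
    simp
  · congr 1
    rw [show (fun x : Fin d → ℝ => ∑ j, b j * x j) = ∑ j, fun x : Fin d → ℝ => b j * x j by
      ext; simp]
    rw [IndepFun.variance_sum (fun j _ => ((hasAllMoments_eval j).const_mul _) 2)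
      fun j _ l _ hjl => hind.indepFun hjl]
    refine sum_congr rfl fun j _ => ?_
    rw [variance_const_mul, (hlaw j).variance_eq]
    simp

theorem integral_sum_mul_pow_stdGauss {d : ℕ} (b : Fin d → ℝ) (n : ℕ) :
    ∫ x, (∑ j, b j * x j) ^ (2 * n) ∂stdGauss d =
      (∑ j, b j ^ 2) ^ n * ∫ x, x ^ (2 * n) ∂gaussianReal 0 1 := by
  have hb : 0 ≤ ∑ j, b j ^ 2 := sum_nonneg fun j _ => sq_nonneg _
  have h1 := integral_map (μ := stdGauss d) (φ := fun x => ∑ j, b j * x j)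
    (f := fun y : ℝ => y ^ (2 * n)) (Measurable.aemeasurable (by fun_prop)) (by fun_prop)
  have h2 : gaussianReal 0 (∑ j, b j ^ 2).toNNReal =
      (gaussianReal 0 1).map (fun y => √(∑ j, b j ^ 2) * y) := by
    rw [gaussianReal_map_const_mul, mul_zero, mul_one]
    congr 1
    ext
    simp [Real.sq_sqrt hb, hb]
  rw [← h1, map_sum_mul_stdGauss, h2, integral_map (by fun_prop) (by fun_prop)]
  simp only [mul_pow]
  rw [integral_const_mul, pow_mul (√_), Real.sq_sqrt hb]

/-! ### Orthogonal and hypercontractive families and their tensor products -/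

/-- The span of the family `E` is hypercontractive from `L²` (with weights `w`) to `L²ᵏ`. -/
def IsHypercontractive {Ω J : Type*} [MeasurableSpace Ω] [Fintype J] (k : ℕ) (μ : Measure Ω)
    (E : J → Ω → ℝ) (w : J → ℝ) : Prop :=
  ∀ b : J → ℝ, ∫ ω, (∑ j, b j * E j ω) ^ (2 * k) ∂μ ≤ (∑ j, w j * b j ^ 2) ^ k

/-- The family `E` is orthogonal in `L²(μ)` with squared norms `s`. -/
def IsOrthogonal {Ω J : Type*} [MeasurableSpace Ω] [DecidableEq J] (μ : Measure Ω)
    (E : J → Ω → ℝ) (s : J → ℝ) : Prop :=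
  ∀ p q : J, ∫ ω, E p ω * E q ω ∂μ = if p = q then s p else 0

section Orthogonal

variable {Ω J : Type*} [MeasurableSpace Ω] {μ : Measure Ω}

theorem HasAllMoments.prod_pi [IsProbabilityMeasure μ] {n : ℕ} {E : J → Ω → ℝ} (hE : ∀ j, HasAllMoments (E j) μ)
    (α : Fin n → J) :
    HasAllMoments (fun x : Fin n → Ω => ∏ t, E (α t) (x t)) (Measure.pi fun _ => μ) :=
  HasAllMoments.finsetProd _ fun t _ =>
    (hE (α t)).comp_measurePreserving (measurePreserving_eval (fun _ => μ) t)

variable [DecidableEq J]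

theorem IsOrthogonal.pi [SigmaFinite μ] {E : J → Ω → ℝ} {s : J → ℝ} (h : IsOrthogonal μ E s)
    (n : ℕ) :
    IsOrthogonal (Measure.pi fun _ : Fin n => μ)
      (fun (α : Fin n → J) x => ∏ t, E (α t) (x t)) (fun α => ∏ t, s (α t)) := by
  intro α β
  simp only [← prod_mul_distrib]
  rw [integral_fintype_prod_eq_prod fun t x => E (α t) x * E (β t) x]
  simp only [h _ _]
  split_ifs with hαβ
  · subst hαβ
    simp
  · obtain ⟨t, ht⟩ := Function.ne_iff.1 hαβ
    exact prod_eq_zero (mem_univ t) (if_neg ht)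

theorem IsOrthogonal.integral_sum_sq [Fintype J] {E : J → Ω → ℝ} {s : J → ℝ}
    (hE : ∀ j, HasAllMoments (E j) μ) (h : IsOrthogonal μ E s) (b : J → ℝ) :
    ∫ ω, (∑ j, b j * E j ω) ^ 2 ∂μ = ∑ j, s j * b j ^ 2 := by
  have hint : ∀ p q, Integrable (fun ω => b p * b q * (E p ω * E q ω)) μ := fun p q =>
    ((hE p).mul (hE q)).integrable.const_mul _
  have e : ∀ ω, (∑ j, b j * E j ω) ^ 2 = ∑ p, ∑ q, b p * b q * (E p ω * E q ω) := by
    intro ω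
    rw [sq, sum_mul_sum]
    exact sum_congr rfl fun p _ => sum_congr rfl fun q _ => by ring
  simp only [e]
  rw [integral_finsetSum _ fun p _ => integrable_finsetSum _ fun q _ => hint p q]
  refine sum_congr rfl fun p _ => ?_
  rw [integral_finsetSum _ fun q _ => hint p q]
  simp only [integral_const_mul, h p _, mul_ite, mul_zero, sum_ite_eq, mem_univ, if_true]
  ring

end Orthogonal

section Tensor

variable {Ω Ω' J J' : Type*} [MeasurableSpace Ω] [MeasurableSpace Ω'] [Fintype J] [Fintype J']
  {μ : Measure Ω} {ν : Measure Ω'} [IsProbabilityMeasure μ] [IsProbabilityMeasure ν] {k : ℕ}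

/-- Minkowski's inequality in `Lᵏ` for nonnegative combinations of squares, positive case. -/
theorem integral_sum_mul_sq_pow_le_of_pos {F : J → Ω → ℝ}
    (hF : ∀ j, HasAllMoments (F j) μ) {w A : J → ℝ} (hw : ∀ j, 0 ≤ w j) (hA : ∀ j, 0 < A j)
    (h : ∀ j, ∫ ω, F j ω ^ (2 * k) ∂μ ≤ A j ^ k) (hk : k ≠ 0) :
    ∫ ω, (∑ j, w j * F j ω ^ 2) ^ k ∂μ ≤ (∑ j, w j * A j) ^ k := by
  have hterm : ∀ j ∈ univ, 0 ≤ w j * A j := fun j _ => mul_nonneg (hw j) (hA j).le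
  rcases (sum_nonneg hterm).eq_or_lt with h0 | hpos
  · have hw0 : ∀ j, w j = 0 := fun j =>
      (mul_eq_zero.1 ((sum_eq_zero_iff_of_nonneg hterm).1 h0.symm j (mem_univ j))).resolve_right
        (hA j).ne'
    simp [hw0, hk]
  set T := ∑ j, w j * A j with hT
  have hsum : ∑ j, w j * A j / T = 1 := by rw [← sum_div, ← hT, div_self hpos.ne']
  have hint : ∀ j, Integrable (fun ω => w j * A j / T * (F j ω ^ (2 * k) / A j ^ k)) μ :=
    fun j => (((hF j).integrable_pow _).div_const _).const_mul _
  calc ∫ ω, (∑ j, w j * F j ω ^ 2) ^ k ∂μ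
      ≤ ∫ ω, T ^ k * ∑ j, w j * A j / T * (F j ω ^ (2 * k) / A j ^ k) ∂μ := by
        refine integral_mono ?_ ((integrable_finsetSum _ fun j _ => hint j).const_mul _) fun ω => ?_
        · exact (HasAllMoments.finsetSum univ fun j _ =>
            ((hF j).pow 2).const_mul (w j)).integrable_pow k
        -- Jensen's inequality for t ↦ t^k with probability weights w_j A_j / T at the points F_j² /
        -- A_j, whose k-th moments are at most 1.
        have hj := Real.pow_arith_mean_le_arith_mean_pow univ (fun j => w j * A j / T)
          (fun j => F j ω ^ 2 / A j) (fun j hj => div_nonneg (hterm j hj) hpos.le) hsum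
          (fun j _ => div_nonneg (sq_nonneg _) (hA j).le) k
        have e1 : ∑ j, w j * F j ω ^ 2 = T * ∑ j, w j * A j / T * (F j ω ^ 2 / A j) := by
          rw [mul_sum]
          refine sum_congr rfl fun j _ => ?_
          have := (hA j).ne'
          field_simp
        simp only [e1, mul_pow]
        refine mul_le_mul_of_nonneg_left (hj.trans_eq (sum_congr rfl fun j _ => ?_)) (by positivity)
        rw [div_pow, ← pow_mul]
    _ = T ^ k * ∑ j, w j * A j / T * ((∫ ω, F j ω ^ (2 * k) ∂μ) / A j ^ k) := by
        rw [integral_const_mul, integral_finsetSum _ fun j _ => hint j]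
        simp only [integral_const_mul, integral_div]
    _ ≤ T ^ k * ∑ j, w j * A j / T * 1 := by
        refine mul_le_mul_of_nonneg_left (sum_le_sum fun j hj => ?_) (by positivity)
        refine mul_le_mul_of_nonneg_left ?_ (div_nonneg (hterm j hj) hpos.le)
        rw [div_le_one (pow_pos (hA j) k)]
        exact h j
    _ = T ^ k := by simp only [mul_one]; rw [hsum, mul_one]

/-- Minkowski's inequality in `Lᵏ` for nonnegative combinations of squares. -/
theorem integral_sum_mul_sq_pow_le {F : J → Ω → ℝ}
    (hF : ∀ j, HasAllMoments (F j) μ) {w A : J → ℝ} (hw : ∀ j, 0 ≤ w j) (hA : ∀ j, 0 ≤ A j)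
    (h : ∀ j, ∫ ω, F j ω ^ (2 * k) ∂μ ≤ A j ^ k) (hk : k ≠ 0) :
    ∫ ω, (∑ j, w j * F j ω ^ 2) ^ k ∂μ ≤ (∑ j, w j * A j) ^ k := by
  -- Dividing by A_j needs A_j > 0, so A_j + η is used and η tends to 0 from above.
  have hcont : Continuous fun η : ℝ => (∑ j, w j * (A j + η)) ^ k := by fun_prop
  have hlim := (hcont.tendsto 0).mono_left (nhdsWithin_le_nhds (s := Set.Ioi 0))
  simp only [add_zero] at hlim
  refine ge_of_tendsto hlim (eventually_nhdsWithin_of_forall fun η hη => ?_)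
  have hη' : 0 < η := hη
  exact integral_sum_mul_sq_pow_le_of_pos hF hw (fun j => add_pos_of_nonneg_of_pos (hA j) hη')
    (fun j => (h j).trans (pow_le_pow_left₀ (hA j) (by linarith) k)) hk

/-- For fixed y, apply the first inequality with the functions ∑_q b(p,q) E'_q(y) of y as
coefficients. Minkowski's inequality in Lᵏ(ν) then moves the sum over p outside, and the second
inequality bounds each coefficient. -/
theorem IsHypercontractive.prod {E : J → Ω → ℝ} {E' : J' → Ω' → ℝ} {w : J → ℝ} {w' : J' → ℝ}
    (hE : ∀ j, HasAllMoments (E j) μ) (hE' : ∀ j, HasAllMoments (E' j) ν)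
    (hw : ∀ j, 0 ≤ w j) (hw' : ∀ j, 0 ≤ w' j)
    (h : IsHypercontractive k μ E w) (h' : IsHypercontractive k ν E' w') (hk : k ≠ 0) :
    IsHypercontractive k (μ.prod ν) (fun (p : J × J') z => E p.1 z.1 * E' p.2 z.2)
      (fun p => w p.1 * w' p.2) := by
  intro b
  have hF : ∀ p, HasAllMoments (fun y => ∑ q, b (p, q) * E' q y) ν := fun p =>
    HasAllMoments.finsetSum _ fun q _ => (hE' q).const_mul _
  have hint : Integrable (fun z : Ω × Ω' =>
      (∑ p : J × J', b p * (E p.1 z.1 * E' p.2 z.2)) ^ (2 * k)) (μ.prod ν) := by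
    refine (HasAllMoments.finsetSum _ fun p _ => HasAllMoments.const_mul _ ?_).integrable_pow _
    exact ((hE p.1).comp_measurePreserving measurePreserving_fst).mul
      ((hE' p.2).comp_measurePreserving measurePreserving_snd)
  have hre : ∀ x y, ∑ p : J × J', b p * (E p.1 x * E' p.2 y) =
      ∑ p, (∑ q, b (p, q) * E' q y) * E p x := by
    intro x y
    rw [Fintype.sum_prod_type]
    refine sum_congr rfl fun p _ => ?_
    rw [sum_mul]
    exact sum_congr rfl fun q _ => by ring
  calc _ = ∫ y, ∫ x, (∑ p : J × J', b p * (E p.1 x * E' p.2 y)) ^ (2 * k) ∂μ ∂ν :=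
        integral_prod_symm _ hint
    _ ≤ ∫ y, (∑ p, w p * (∑ q, b (p, q) * E' q y) ^ 2) ^ k ∂ν := by
        refine integral_mono hint.integral_prod_right ?_ fun y => ?_
        · exact (HasAllMoments.finsetSum _ fun p _ =>
            ((hF p).pow 2).const_mul (w p)).integrable_pow k
        simp only [hre]
        exact h fun p => ∑ q, b (p, q) * E' q y
    _ ≤ (∑ p, w p * ∑ q, w' q * b (p, q) ^ 2) ^ k :=
        integral_sum_mul_sq_pow_le hF hw
          (fun p => sum_nonneg fun q _ => mul_nonneg (hw' q) (sq_nonneg _))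
          (fun p => h' fun q => b (p, q)) hk
    _ = _ := by
        congr 1
        rw [Fintype.sum_prod_type]
        refine sum_congr rfl fun p _ => ?_
        rw [mul_sum]
        exact sum_congr rfl fun q _ => by ring

theorem IsHypercontractive.pi {E : J → Ω → ℝ} {w : J → ℝ}
    (hE : ∀ j, HasAllMoments (E j) μ) (hw : ∀ j, 0 ≤ w j)
    (h : IsHypercontractive k μ E w) (hk : k ≠ 0) (n : ℕ) :
    IsHypercontractive k (Measure.pi fun _ : Fin n => μ)
      (fun (α : Fin n → J) x => ∏ t, E (α t) (x t)) (fun α => ∏ t, w (α t)) := by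
  induction n with
  | zero =>
    intro b
    simp [pow_mul]
  | succ n ih =>
    intro b
    have hprod := h.prod hE (HasAllMoments.prod_pi hE) hw
      (fun α => prod_nonneg fun t _ => hw (α t)) ih hk
      fun p => b (Fin.cons p.1 p.2)
    have hmp := measurePreserving_piFinSuccAbove (fun _ : Fin (n + 1) => μ) 0
    have hsum : ∀ f : (Fin (n + 1) → J) → ℝ,
        ∑ α, f α = ∑ p : J × (Fin n → J), f (Fin.cons p.1 p.2) := fun f =>
      (Fintype.sum_equiv (Fin.consEquiv fun _ => J) _ _ fun _ => rfl).symm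
    rw [← hmp.integral_comp'] at hprod
    simp only [hsum, Fin.prod_univ_succ, Fin.cons_zero, Fin.cons_succ]
    exact hprod

end Tensor

/-! ### Hypercontractivity for a single Gaussian vector -/

/-- The centred products `x_i x_j - δ_{ij}` and the constant `1`. -/
def blockVar {d : ℕ} (i : Fin d) : Option (Fin d) → (Fin d → ℝ) → ℝ
  | none, _ => 1
  | some j, x => x i * x j - if j = i then 1 else 0

/-- The squared norms of the functions `blockVar i`. -/
def blockSq {d : ℕ} (i : Fin d) : Option (Fin d) → ℝ
  | none => 1
  | some j => if j = i then 2 else 1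

/-- The hypercontractive weights of the functions `blockVar i`. -/
def blockWeight {d : ℕ} (M : ℝ) (i : Fin d) : Option (Fin d) → ℝ
  | none => 1
  | some j => M * if j = i then 2 else 1

theorem hasAllMoments_mul_eval {d : ℕ} (i j : Fin d) :
    HasAllMoments (fun x => x i * x j) (stdGauss d) :=
  (hasAllMoments_eval i).mul (hasAllMoments_eval j)

theorem hasAllMoments_blockVar {d : ℕ} (i : Fin d) (p : Option (Fin d)) :
    HasAllMoments (blockVar i p) (stdGauss d) := by
  cases p with
  | none => exact HasAllMoments.const 1
  | some j => exact (hasAllMoments_mul_eval i j).sub (HasAllMoments.const _)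

theorem integral_blockVar_some {d : ℕ} (i j : Fin d) :
    ∫ x, blockVar i (some j) x ∂stdGauss d = 0 := by
  simp only [blockVar]
  rw [integral_sub (hasAllMoments_mul_eval i j).integrable (integrable_const _),
    integral_mul_stdGauss]
  simp

theorem isOrthogonal_blockVar {d : ℕ} (i : Fin d) :
    IsOrthogonal (stdGauss d) (blockVar i) (blockSq i) := by
  intro p q
  rcases p with - | j <;> rcases q with - | l
  · simp [blockVar, blockSq]
  · simpa [blockVar] using integral_blockVar_some i l
  · simpa [blockVar] using integral_blockVar_some i j
  · have e : ∀ x : Fin d → ℝ, blockVar i (some j) x * blockVar i (some l) x =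
        ((x i * x j) * (x i * x l) - (if l = i then 1 else 0) * (x i * x j)) -
          (if j = i then 1 else 0) * blockVar i (some l) x := by
      intro x; simp only [blockVar]; ring
    simp only [e]
    rw [integral_sub, integral_sub, integral_const_mul, integral_const_mul,
      integral_blockVar_some, integral_mul_stdGauss, integral_mul_mul_mul_stdGauss]
    · by_cases hjl : j = l
      · subst hjl
        by_cases hji : j = i <;> simp [hji, blockSq]
        norm_num
      · by_cases hji : j = i
        · have : l ≠ i := fun h => hjl (hji.trans h.symm)
          simp [hjl, this]
        · simp [hjl, hji]
    · exact ((hasAllMoments_mul_eval i j).mul (hasAllMoments_mul_eval i l)).integrable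
    · exact (hasAllMoments_mul_eval i j).integrable.const_mul _
    · exact (((hasAllMoments_mul_eval i j).mul (hasAllMoments_mul_eval i l)).sub
        ((hasAllMoments_mul_eval i j).const_mul _)).integrable
    · exact (hasAllMoments_blockVar i (some l)).integrable.const_mul _

/-- The even moments of `x_i ∑ b_j x_j - b_i` under the standard Gaussian measure. -/
theorem integral_mul_sum_sub_pow_le {d : ℕ} (i : Fin d) (b : Fin d → ℝ) {n : ℕ} (hn : 1 ≤ n) :
    ∫ x, (x i * ∑ j, b j * x j - b i) ^ (2 * n) ∂stdGauss d ≤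
      16 ^ n * (2 * n).factorial * (∑ j, b j ^ 2) ^ n := by
  set B := ∑ j, b j ^ 2 with hB
  have hB0 : 0 ≤ B := sum_nonneg fun j _ => sq_nonneg _
  have hh : HasAllMoments (fun x => ∑ j, b j * x j) (stdGauss d) :=
    HasAllMoments.finsetSum _ fun j _ => (hasAllMoments_eval j).const_mul _
  have hp : HasAllMoments (fun x => x i * ∑ j, b j * x j) (stdGauss d) :=
    (hasAllMoments_eval i).mul hh
  set G := ∫ x, x ^ (2 * (2 * n)) ∂gaussianReal 0 1 with hG
  have hG1 : 1 ≤ G := one_le_integral_pow_two_mul_gaussianReal _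
  have hG2 : G ≤ 4 ^ n * (2 * n).factorial := by
    refine (integral_pow_two_mul_gaussianReal_le (2 * n)).trans_eq ?_
    rw [pow_mul]; norm_num
  have hxi : ∫ x, x i ^ (2 * (2 * n)) ∂stdGauss d = G := by
    have := integral_sum_mul_pow_stdGauss (fun j => if j = i then 1 else 0) (2 * n)
    simpa using this
  have hbi : b i ^ 2 ≤ B := single_le_sum (f := fun j => b j ^ 2) (fun j _ => sq_nonneg _)
    (mem_univ i)
  have hprod : ∫ x, (x i * ∑ j, b j * x j) ^ (2 * n) ∂stdGauss d ≤ B ^ n * G := by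
    rcases hB0.eq_or_lt with h0 | hpos
    · have hb : ∀ j, b j = 0 := fun j => by
        have := (sum_eq_zero_iff_of_nonneg fun j _ => sq_nonneg (b j)).1 (hB ▸ h0.symm) j
          (mem_univ j)
        simpa using this
      simp [hb, ← h0, (show n ≠ 0 by omega)]
    -- The factor B^n balances 2uv ≤ u² + v² for u = B^n x_i^(2n) and v = (∑ b_j x_j)^(2n): both
    -- squares have integral B^(2n) G. Cancelling it afterwards needs B > 0.
    have h1 : B ^ n * ∫ x, (x i * ∑ j, b j * x j) ^ (2 * n) ∂stdGauss d ≤ B ^ n * (B ^ n * G) := by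
      rw [← integral_const_mul]
      calc ∫ x, B ^ n * (x i * ∑ j, b j * x j) ^ (2 * n) ∂stdGauss d
          ≤ ∫ x, (1 / 2) * ((B ^ n) ^ 2 * x i ^ (2 * (2 * n)) +
              (∑ j, b j * x j) ^ (2 * (2 * n))) ∂stdGauss d := by
            refine integral_mono ((hp.integrable_pow _).const_mul _)
              (((((hasAllMoments_eval i).integrable_pow _).const_mul _).add
                (hh.integrable_pow _)).const_mul _) fun x => ?_
            have := sq_nonneg (B ^ n * x i ^ (2 * n) - (∑ j, b j * x j) ^ (2 * n))
            have e1 : x i ^ (2 * (2 * n)) = (x i ^ (2 * n)) ^ 2 := by rw [← pow_mul, mul_comm]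
            have e2 : (∑ j, b j * x j) ^ (2 * (2 * n)) = ((∑ j, b j * x j) ^ (2 * n)) ^ 2 := by
              rw [← pow_mul, mul_comm]
            simp only [mul_pow (x i), e1, e2]
            nlinarith
        _ = B ^ n * (B ^ n * G) := by
            rw [integral_const_mul, integral_add
              (((hasAllMoments_eval i).integrable_pow _).const_mul _) (hh.integrable_pow _),
              integral_const_mul, hxi, integral_sum_mul_pow_stdGauss, ← hB, ← hG, pow_mul B 2 n,
              ← pow_mul B n 2, mul_comm n 2, pow_mul B 2 n]
            ring
    exact le_of_mul_le_mul_left h1 (pow_pos hpos n)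
  calc ∫ x, (x i * ∑ j, b j * x j - b i) ^ (2 * n) ∂stdGauss d
      ≤ ∫ x, 2 ^ (2 * n - 1) * ((x i * ∑ j, b j * x j) ^ (2 * n) + b i ^ (2 * n))
          ∂stdGauss d := by
        refine integral_mono ((hp.sub (HasAllMoments.const _)).integrable_pow _)
          (((hp.integrable_pow _).add (integrable_const _)).const_mul _) fun x => ?_
        have := (even_two_mul n).add_pow_le (a := x i * ∑ j, b j * x j) (b := -b i)
        rwa [(even_two_mul n).neg_pow, ← sub_eq_add_neg] at this
    _ = 2 ^ (2 * n - 1) * (∫ x, (x i * ∑ j, b j * x j) ^ (2 * n) ∂stdGauss d + (b i ^ 2) ^ n) := by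
        rw [integral_const_mul, integral_add (hp.integrable_pow _) (integrable_const _)]
        simp [pow_mul]
    _ ≤ 2 ^ (2 * n - 1) * (B ^ n * G + B ^ n * G) := by
        have h2 : (b i ^ 2) ^ n ≤ B ^ n * G :=
          (pow_le_pow_left₀ (sq_nonneg _) hbi n).trans
            (le_mul_of_one_le_right (pow_nonneg hB0 n) hG1)
        gcongr
    _ ≤ 4 ^ n * (B ^ n * G) := by
        rw [show (4 : ℝ) = 2 ^ 2 by norm_num, ← pow_mul]
        conv_rhs => rw [show 2 * n = 2 * n - 1 + 1 by omega, pow_succ]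
        apply le_of_eq
        ring
    -- One factor 4^n comes from splitting off b_i, the other from the Gaussian moment of order 4n;
    -- together they give 16^n.
    _ ≤ 4 ^ n * (B ^ n * (4 ^ n * (2 * n).factorial)) := by gcongr
    _ = _ := by rw [show (16 : ℝ) = 4 * 4 by norm_num, mul_pow]; ring

theorem isHypercontractive_blockVar {d : ℕ} (k : ℕ) (i : Fin d) :
    IsHypercontractive k (stdGauss d) (blockVar i) (blockWeight (256 * k ^ 2) i) := by
  intro b
  set Q : (Fin d → ℝ) → ℝ := fun x => ∑ j, b (some j) * blockVar i (some j) x with hQ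
  have hQm : HasAllMoments Q (stdGauss d) := HasAllMoments.finsetSum _ fun j _ =>
    (hasAllMoments_blockVar i (some j)).const_mul _
  have hQe : ∀ x, Q x = x i * ∑ j, b (some j) * x j - b (some i) := by
    intro x
    simp only [hQ, blockVar, mul_sub, sum_sub_distrib, mul_ite, mul_one, mul_zero, sum_ite_eq',
      mem_univ, if_true, mul_sum]
    congr 1
    exact sum_congr rfl fun j _ => by ring
  have hQ0 : ∫ x, Q x ∂stdGauss d = 0 := by
    simp only [hQ]
    rw [integral_finsetSum _ fun j _ =>
      ((hasAllMoments_blockVar i (some j)).const_mul _).integrable]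
    simp only [integral_const_mul, integral_blockVar_some, mul_zero, sum_const_zero]
  -- This is the squared L² norm of `Q`. The moment bound would allow the smaller ∑ b_j²; the larger
  -- value makes the weights proportional to `blockSq`, as the comparison with the L² norm requires.
  set σ := ∑ j, (if j = i then 2 else 1) * b (some j) ^ 2 with hσ
  have hle : ∑ j, b (some j) ^ 2 ≤ σ := sum_le_sum fun j _ => by
    split_ifs <;> nlinarith [sq_nonneg (b (some j))]
  have hB0 : 0 ≤ ∑ j, b (some j) ^ 2 := sum_nonneg fun j _ => sq_nonneg _
  have key := integral_const_add_pow_le hQm hQ0 (D := 16) (by norm_num) (hB0.trans hle)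
    (fun n hn => by
      simp only [hQe]
      refine (integral_mul_sum_sub_pow_le i (fun j => b (some j)) hn).trans ?_
      gcongr) k (b none)
  have e1 : ∀ x, ∑ p, b p * blockVar i p x = b none + Q x := by
    intro x; rw [Fintype.sum_option]; simp [blockVar, hQ]
  have e2 : ∑ p, blockWeight (256 * k ^ 2) i p * b p ^ 2 =
      b none ^ 2 + 16 * 16 * k ^ 2 * σ := by
    rw [Fintype.sum_option, hσ, mul_sum]
    simp only [blockWeight, one_mul]
    congr 1
    exact sum_congr rfl fun j _ => by ring
  simp only [e1, e2]
  exact key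

/-! ### Explicit formulas for the estimator and the variance bound -/

section Formulas

theorem contract_eq_sum {d : ℕ} : ∀ {m : ℕ} (A : Tensor (m + 1) d) (g : Fin m → Fin d → ℝ)
    (i : Fin d), contract A g i = ∑ j : Fin m → Fin d, entry A j i * ∏ t, g t (j t)
  | 0, A, g, i => by
    simp only [contract, univ_unique, sum_singleton, univ_eq_empty, prod_empty, mul_one, entry]
    congr 1
  | m + 1, A, g, i => by
    rw [contract, contract_eq_sum]
    have hsum : ∀ f : (Fin (m + 1) → Fin d) → ℝ,
        ∑ j, f j = ∑ p : Fin d × (Fin m → Fin d), f (Fin.cons p.1 p.2) := fun f =>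
      (Fintype.sum_equiv (Fin.consEquiv fun _ => Fin d) _ _ fun _ => rfl).symm
    rw [hsum, Fintype.sum_prod_type, sum_comm]
    refine sum_congr rfl fun j _ => ?_
    simp only [entry, modeMul, Fin.insertNth_zero', sum_mul, Fin.prod_univ_succ, Fin.cons_zero,
      Fin.cons_succ, Fin.cons_snoc_eq_snoc_cons]
    exact sum_congr rfl fun l _ => by ring

/-- Pairing g_i with g_{j_t} within each t makes every summand a product of functions of independent
vectors. -/
theorem diagEstimator_eq_sum {m d : ℕ} (A : Tensor (m + 1) d) (g : Fin m → Fin d → ℝ)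
    (i : Fin d) :
    diagEstimator A g i = ∑ j : Fin m → Fin d, entry A j i * ∏ t, g t i * g t (j t) := by
  rw [diagEstimator, Pi.mul_apply, contract_eq_sum, Finset.prod_apply, mul_sum]
  refine sum_congr rfl fun j _ => ?_
  rw [prod_mul_distrib]
  ring

theorem entry_const {m d : ℕ} (A : Tensor (m + 1) d) (i : Fin d) :
    entry A (fun _ => i) i = diagEntry A i := by
  rw [entry, diagEntry]
  congr 1
  ext t
  refine Fin.lastCases ?_ (fun t => ?_) t <;> simp

theorem sum_pow_mul_levelSq {m d : ℕ} (A : Tensor (m + 1) d) (i : Fin d) :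
    ∑ s ∈ range (m + 1), (3 : ℝ) ^ s * levelSq A i s =
      ∑ j : Fin m → Fin d, 3 ^ #{t : Fin m | j t = i} * entry A j i ^ 2 := by
  rw [← sum_fiberwise_of_maps_to (s := univ) (t := range (m + 1))
    (g := fun j : Fin m → Fin d => #{t : Fin m | j t = i})]
  · refine sum_congr rfl fun s _ => ?_
    rw [levelSq, mul_sum]
    refine sum_congr rfl fun j hj => ?_
    rw [(mem_filter.1 hj).2]
  · intro j _
    rw [mem_range, Nat.lt_succ_iff]
    simpa using card_le_univ (filter (fun t : Fin m => j t = i) univ)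

/-- A nonconstant multi-index has some j_t ≠ i, so at most m - 1 of its entries equal i. The
constant one contributes exactly 3^m times the squared diagonal entry. -/
theorem sum_pow_mul_levelSq_sub_le_varBound {m d : ℕ} (A : Tensor (m + 1) d)
    (i : Fin d) :
    (∑ s ∈ range (m + 1), (3 : ℝ) ^ s * levelSq A i s) - diagEntry A i ^ 2 ≤ varBound A i := by
  rw [sum_pow_mul_levelSq, varBound, offDiagSq,
    ← sum_filter_add_sum_filter_not univ (fun j : Fin m → Fin d => j = fun _ => i)]
  have h1 : ∑ j : Fin m → Fin d with j = fun _ => i, (3 : ℝ) ^ #{t : Fin m | j t = i} *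
      entry A j i ^ 2 = 3 ^ m * diagEntry A i ^ 2 := by
    rw [filter_eq' univ (fun _ : Fin m => i)]
    simp [entry_const]
  have h2 : ∑ j : Fin m → Fin d with ¬ j = fun _ => i, (3 : ℝ) ^ #{t : Fin m | j t = i} *
      entry A j i ^ 2 ≤ 3 ^ (m - 1) * ∑ j : Fin m → Fin d with j ≠ fun _ => i, entry A j i ^ 2 := by
    rw [mul_sum]
    refine sum_le_sum fun j hj => ?_
    have hne : j ≠ fun _ => i := (mem_filter.1 hj).2
    obtain ⟨t, ht⟩ := Function.ne_iff.1 hne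
    have hlt : #{t : Fin m | j t = i} < m := by
      simpa using card_lt_univ_of_notMem (s := filter (fun t : Fin m => j t = i) univ) (x := t)
        (by simp [ht])
    have hpow : (3 : ℝ) ^ #{t : Fin m | j t = i} ≤ 3 ^ (m - 1) :=
      pow_le_pow_right₀ (by norm_num) (by omega)
    exact mul_le_mul_of_nonneg_right hpow (sq_nonneg _)
  linarith

theorem varBound_pos {m d : ℕ} (hm : 1 ≤ m) (A : Tensor (m + 1) d) (i : Fin d)
    (h : diagEntry A i ≠ 0) : 0 < varBound A i := by
  have h3 : (1 : ℝ) < 3 ^ m := one_lt_pow₀ (by norm_num) (by omega)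
  have h0 : 0 ≤ offDiagSq A i := sum_nonneg fun j _ => sq_nonneg _
  have := mul_pos (sub_pos.2 h3) (pow_pos (abs_pos.2 h) 2)
  rw [sq_abs] at this
  exact add_pos_of_pos_of_nonneg this (by positivity)

end Formulas

/-! ### From i.i.d. entries to nested product measures -/

section Law

/-- Under the nested product all coordinates are jointly independent with law ν, so their joint law
is the flat product; currying inverts this. It links hypotheses indexed by all entries at once to
integrals taken block by block. -/
theorem measurePreserving_curry {α β E : Type*} [Fintype α] [Fintype β] [MeasurableSpace E]
    (ν : Measure E) [IsProbabilityMeasure ν] :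
    MeasurePreserving (fun (x : α × β → E) a b => x (a, b)) (Measure.pi fun _ => ν)
      (Measure.pi fun _ => Measure.pi fun _ => ν) := by
  have hc : Measurable fun (x : α × β → E) a b => x (a, b) := by fun_prop
  have hu : Measurable fun (x : α → β → E) (p : α × β) => x p.1 p.2 := by fun_prop
  refine ⟨hc, ?_⟩
  have hlaw : ∀ p : α × β, (Measure.pi fun _ : α => Measure.pi fun _ : β => ν).map
      (fun x => x p.1 p.2) = ν := fun p =>
    ((measurePreserving_eval (fun _ : β => ν) p.2).comp
      (measurePreserving_eval (fun _ : α => Measure.pi fun _ : β => ν) p.1)).map_eq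
  have hind : iIndepFun (fun (p : α × β) (x : α → β → E) => x p.1 p.2)
      (Measure.pi fun _ : α => Measure.pi fun _ : β => ν) := by
    refine iIndepFun_uncurry' (X := fun a b (x : α → β → E) => x a b) (by fun_prop) ?_ fun a => ?_
    · exact iIndepFun_pi (X := fun _ (y : β → E) => y) fun _ => aemeasurable_id
    · have h := iIndepFun_pi (μ := fun _ : β => ν) (X := fun _ (y : E) => y)
        fun _ => aemeasurable_id
      rw [iIndepFun_iff_map_fun_eq_pi_map fun b => Measurable.aemeasurable (by fun_prop)]
      simp only [fun b => hlaw (a, b)]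
      exact (measurePreserving_eval (fun _ : α => Measure.pi fun _ : β => ν) a).map_eq
  have h1 := hind.map_fun_eq_pi_map fun p => Measurable.aemeasurable (by fun_prop)
  simp only [hlaw] at h1
  rw [← h1, Measure.map_map hc hu]
  exact Measure.map_id

variable {Ω : Type*} [MeasurableSpace Ω] {μ : Measure Ω}

theorem IsIIDStdNormal.hasLaw_pi {ι : Type*} [Fintype ι] {X : ι → Ω → ℝ}
    (h : IsIIDStdNormal X μ) :
    HasLaw (fun ω k => X k ω) (Measure.pi fun _ => gaussianReal 0 1) μ where
  aemeasurable := aemeasurable_pi_lambda _ fun k => (h.2 k).aemeasurable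
  map_eq := by
    have := h.1.isProbabilityMeasure
    rw [h.1.map_fun_eq_pi_map fun k => (h.2 k).aemeasurable]
    simp only [(h.2 _).map_eq]

theorem IsIIDStdNormal.hasLaw_pi_stdGauss {m d : ℕ} {g : Fin m → Fin d → Ω → ℝ}
    (h : IsIIDStdNormal (fun x : Fin m × Fin d => g x.1 x.2) μ) :
    HasLaw (fun ω t j => g t j ω) (Measure.pi fun _ => stdGauss d) μ :=
  (measurePreserving_curry _).hasLaw.comp h.hasLaw_pi

theorem IsIIDStdNormal.hasLaw_pi_pi_stdGauss {K m d : ℕ} {g : Fin K → Fin m → Fin d → Ω → ℝ}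
    (h : IsIIDStdNormal (fun x : Fin K × Fin m × Fin d => g x.1 x.2.1 x.2.2) μ) :
    HasLaw (fun ω k t j => g k t j ω)
      (Measure.pi fun _ => Measure.pi fun _ => stdGauss d) μ :=
  (measurePreserving_pi _ _
    fun _ : Fin K => measurePreserving_curry (gaussianReal 0 1)).hasLaw.comp
    ((measurePreserving_curry (gaussianReal 0 1)).hasLaw.comp h.hasLaw_pi)

end Law

/-! ### Mean and variance of one estimate -/

section Variance

variable {m d : ℕ} (A : Tensor (m + 1) d) (i : Fin d)

theorem measurable_diagEstimator : Measurable fun x : Fin m → Fin d → ℝ => diagEstimator A x i := by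
  simp only [diagEstimator_eq_sum]
  fun_prop

theorem hasAllMoments_diagEstimator :
    HasAllMoments (fun x => diagEstimator A x i) (Measure.pi fun _ => stdGauss d) := by
  simp only [diagEstimator_eq_sum]
  exact HasAllMoments.finsetSum _ fun j _ =>
    (HasAllMoments.prod_pi (E := fun j (x : Fin d → ℝ) => x i * x j) (hasAllMoments_mul_eval i) j).const_mul _

theorem integral_diagEstimator :
    ∫ x, diagEstimator A x i ∂(Measure.pi fun _ => stdGauss d) = diagEntry A i := by
  simp only [diagEstimator_eq_sum]
  rw [integral_finsetSum _ fun j _ =>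
    ((HasAllMoments.prod_pi (E := fun j (x : Fin d → ℝ) => x i * x j)
      (hasAllMoments_mul_eval i) j).const_mul _).integrable]
  rw [sum_eq_single fun _ => i]
  · rw [integral_const_mul, integral_fintype_prod_eq_prod fun _ (x : Fin d → ℝ) => x i * x i]
    simp [integral_mul_stdGauss, entry_const]
  · intro j _ hj
    obtain ⟨t, ht⟩ := Function.ne_iff.1 hj
    rw [integral_const_mul, integral_fintype_prod_eq_prod fun t (x : Fin d → ℝ) => x i * x (j t)]
    rw [prod_eq_zero (mem_univ t) (by rw [integral_mul_stdGauss, if_neg ht]), mul_zero]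
  · simp

theorem integral_diagEstimator_sq :
    ∫ x, diagEstimator A x i ^ 2 ∂(Measure.pi fun _ => stdGauss d) =
      ∑ s ∈ range (m + 1), (3 : ℝ) ^ s * levelSq A i s := by
  -- The uncentred products x_i x_j are already orthogonal, with squared norms 3 and 1.
  have horth : IsOrthogonal (stdGauss d) (fun j x => x i * x j)
    (fun j => if j = i then 3 else 1) := integral_mul_mul_mul_stdGauss i
  simp only [diagEstimator_eq_sum]
  rw [(horth.pi m).integral_sum_sq (HasAllMoments.prod_pi (hasAllMoments_mul_eval i)),
    sum_pow_mul_levelSq]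
  refine sum_congr rfl fun j _ => ?_
  rw [prod_ite]
  simp

theorem variance_diagEstimator :
    variance (fun x => diagEstimator A x i) (Measure.pi fun _ => stdGauss d) =
      (∑ s ∈ range (m + 1), (3 : ℝ) ^ s * levelSq A i s) - diagEntry A i ^ 2 := by
  rw [variance_eq_sub (hasAllMoments_diagEstimator A i 2), integral_diagEstimator]
  simp only [Pi.pow_apply]
  rw [integral_diagEstimator_sq]

end Variance

/-! ### Chaos of bounded degree -/

section Chaos

variable {d : ℕ}

/-- The law of `K` independent copies of `m` independent standard Gaussian vectors. -/
noncomputable abbrev sampleMeasure (K m d : ℕ) : Measure (Fin K → Fin m → Fin d → ℝ) :=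
  Measure.pi fun _ => Measure.pi fun _ => stdGauss d

/-- Products of the functions `blockVar i` over the blocks of the sample space. -/
def blockProd (i : Fin d) {K m : ℕ} (α : Fin K → Fin m → Option (Fin d))
    (x : Fin K → Fin m → Fin d → ℝ) : ℝ :=
  ∏ k, ∏ t, blockVar i (α k t) (x k t)

/-- The number of blocks on which a product of the functions `blockVar i` depends. -/
def blockDegree {K m : ℕ} (α : Fin K → Fin m → Option (Fin d)) : ℕ :=
  #{p : Fin K × Fin m | α p.1 p.2 ≠ none}

/-- The span of the products `blockProd i α` of degree at most `r`. -/
def chaos (i : Fin d) (K m r : ℕ) : Submodule ℝ ((Fin K → Fin m → Fin d → ℝ) → ℝ) :=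
  Submodule.span ℝ (blockProd i '' {α | blockDegree α ≤ r})

theorem prod_blockWeight (i : Fin d) {K m : ℕ} (M : ℝ) (α : Fin K → Fin m → Option (Fin d)) :
    ∏ k, ∏ t, blockWeight M i (α k t) = M ^ blockDegree α * ∏ k, ∏ t, blockSq i (α k t) := by
  have h : ∀ p, blockWeight M i p = (if p ≠ none then M else 1) * blockSq i p := by
    rintro (- | j) <;> simp [blockWeight, blockSq]
  simp only [h, prod_mul_distrib]
  congr 1
  rw [blockDegree, ← Fintype.prod_prod_type' (fun k t => if α k t ≠ none then M else 1), prod_ite]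
  simp

theorem blockSq_nonneg (i : Fin d) (p : Option (Fin d)) : 0 ≤ blockSq i p := by
  rcases p with - | j
  · simp [blockSq]
  · simp only [blockSq]; split_ifs <;> norm_num

theorem blockWeight_nonneg {M : ℝ} (hM : 0 ≤ M) (i : Fin d) (p : Option (Fin d)) :
    0 ≤ blockWeight M i p := by
  rcases p with - | j
  · simp [blockWeight]
  · simp only [blockWeight]; split_ifs <;> positivity

theorem exists_eq_sum_of_mem_chaos {i : Fin d} {K m r : ℕ}
    {f : (Fin K → Fin m → Fin d → ℝ) → ℝ} (hf : f ∈ chaos i K m r) :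
    ∃ c : (Fin K → Fin m → Option (Fin d)) → ℝ, (∀ α, c α ≠ 0 → blockDegree α ≤ r) ∧
      ∀ x, f x = ∑ α, c α * blockProd i α x := by
  refine Submodule.span_induction ?_ ?_ ?_ ?_ hf
  · rintro _ ⟨α, hα, rfl⟩
    refine ⟨fun β => if β = α then 1 else 0, fun β hβ => ?_, fun x => by simp⟩
    have : β = α := by simpa using hβ
    exact this ▸ hα
  · exact ⟨0, by simp, by simp⟩
  · rintro f g - - ⟨c, hc, hcf⟩ ⟨c', hc', hcg⟩
    refine ⟨c + c', fun α hα => ?_, fun x => ?_⟩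
    · by_cases h : c α = 0
      · exact hc' α fun h' => hα (by simp [h, h'])
      · exact hc α h
    · simp [hcf, hcg, add_mul, sum_add_distrib]
  · rintro a f - ⟨c, hc, hcf⟩
    refine ⟨a • c, fun α hα => hc α fun h => hα (by simp [h]), fun x => ?_⟩
    simp [hcf, mul_sum, mul_assoc]

/-- Hypercontractivity on the chaos of degree at most `r`. -/
theorem integral_pow_le_of_mem_chaos {i : Fin d} {K m r : ℕ}
    {f : (Fin K → Fin m → Fin d → ℝ) → ℝ} (hf : f ∈ chaos i K m r) {k : ℕ} (hk : k ≠ 0) :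
    ∫ x, f x ^ (2 * k) ∂sampleMeasure K m d ≤
      ((256 * (k : ℝ) ^ 2) ^ r * ∫ x, f x ^ 2 ∂sampleMeasure K m d) ^ k := by
  obtain ⟨c, hc, hcf⟩ := exists_eq_sum_of_mem_chaos hf
  have hk1 : (1 : ℝ) ≤ k := by exact_mod_cast Nat.one_le_iff_ne_zero.2 hk
  have hM : (1 : ℝ) ≤ 256 * (k : ℝ) ^ 2 := by nlinarith
  have hm1 : ∀ α : Fin m → Option (Fin d),
      HasAllMoments (fun x => ∏ t, blockVar i (α t) (x t)) (Measure.pi fun _ => stdGauss d) :=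
    HasAllMoments.prod_pi (hasAllMoments_blockVar i)
  have hw := blockWeight_nonneg (M := 256 * (k : ℝ) ^ 2) (by positivity) i
  -- Tensorise twice: over the m vectors of one sample, then over the K samples.
  have hhyp := (((isHypercontractive_blockVar k i).pi (hasAllMoments_blockVar i) hw hk m).pi
    hm1 (fun α => prod_nonneg fun t _ => hw (α t)) hk K) c
  have horth := (((isOrthogonal_blockVar i).pi m).pi K).integral_sum_sq
    (HasAllMoments.prod_pi hm1) c
  have e : ∀ x, f x = ∑ α : Fin K → Fin m → Option (Fin d),
    c α * ∏ k, ∏ t, blockVar i (α k t) (x k t) := hcf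
  simp only [e]
  refine hhyp.trans ?_
  have hs : ∀ α : Fin K → Fin m → Option (Fin d), 0 ≤ ∏ k, ∏ t, blockSq i (α k t) := fun α =>
    prod_nonneg fun k _ => prod_nonneg fun t _ => blockSq_nonneg i _
  refine pow_le_pow_left₀ (sum_nonneg fun α _ => mul_nonneg
    (prod_nonneg fun k _ => prod_nonneg fun t _ => hw _) (sq_nonneg _)) ?_ k
  rw [horth, mul_sum]
  refine sum_le_sum fun α _ => ?_
  rw [prod_blockWeight, mul_assoc]
  -- Only indices of degree at most r carry a nonzero coefficient, and the base 256 k² is at least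
  -- 1, so r may replace the degree as exponent.
  by_cases h : c α = 0
  · simp [h]
  · exact mul_le_mul_of_nonneg_right (pow_le_pow_right₀ hM (hc α h))
      (mul_nonneg (hs α) (sq_nonneg _))

theorem const_mem_chaos (i : Fin d) (K m r : ℕ) (a : ℝ) : (fun _ => a) ∈ chaos i K m r := by
  have h : blockProd i (fun _ _ => none) ∈ chaos i K m r :=
    Submodule.subset_span ⟨_, by simp [blockDegree], rfl⟩
  have h2 : (fun _ => a) = a • blockProd i (K := K) (m := m) (fun _ _ => none) := by
    ext x; simp [blockProd, blockVar]
  rw [h2]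
  exact Submodule.smul_mem _ a h

/-- Write each factor as its centred version plus δ and expand over the set T of positions where the
centred one is chosen. Only the m blocks of sample k are touched, so the degree is at most m. -/
theorem prod_mul_mem_chaos (i : Fin d) {K m : ℕ} (k : Fin K) (j : Fin m → Fin d) :
    (fun x => ∏ t, x k t i * x k t (j t)) ∈ chaos i K m m := by
  have hexp : (fun x : Fin K → Fin m → Fin d → ℝ => ∏ t, x k t i * x k t (j t)) =
      ∑ T ∈ univ.powerset, (∏ t ∈ univ \ T, if j t = i then (1 : ℝ) else 0) •
        blockProd i fun k' t => if k' = k ∧ t ∈ T then some (j t) else none := by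
    ext x
    have h1 : ∀ t, x k t i * x k t (j t) =
        blockVar i (some (j t)) (x k t) + if j t = i then (1 : ℝ) else 0 := by
      intro t; simp [blockVar]
    simp only [h1, prod_add, Finset.sum_apply, Pi.smul_apply, smul_eq_mul]
    refine sum_congr rfl fun T _ => ?_
    rw [mul_comm]
    congr 1
    rw [blockProd, prod_eq_single k]
    · rw [← prod_subset (subset_univ T)]
      · exact prod_congr rfl fun t ht => by simp [ht]
      · intro t _ ht; simp [ht, blockVar]
    · intro k' _ hk'
      exact prod_eq_one fun t _ => by simp [hk', blockVar]
    · simp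
  rw [hexp]
  refine Submodule.sum_mem _ fun T _ => Submodule.smul_mem _ _ (Submodule.subset_span ⟨_, ?_, rfl⟩)
  have hsub : (filter (fun p : Fin K × Fin m =>
      (if p.1 = k ∧ p.2 ∈ T then some (j p.2) else none) ≠ none) univ) ⊆ {k} ×ˢ univ := by
    intro p hp
    have hp' : p.1 = k ∧ p.2 ∈ T := by
      by_contra h
      simp [h] at hp
    exact mem_product.2 ⟨mem_singleton.2 hp'.1, mem_univ _⟩
  simpa [blockDegree] using card_le_card hsub

end Chaos

/-! ### The average of K estimates -/

section Average

variable {m d : ℕ} (A : Tensor (m + 1) d) (i : Fin d) (K : ℕ)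

/-- The average of the diagonal estimators over a sample. -/
noncomputable def averageEstimator (x : Fin K → Fin m → Fin d → ℝ) : ℝ :=
  (1 / (K : ℝ)) * ∑ k, diagEstimator A (x k) i

theorem measurable_averageEstimator : Measurable (averageEstimator A i K) := by
  have h := measurable_diagEstimator A i
  exact (Finset.measurable_fun_sum _ fun k _ => h.comp (measurable_pi_apply k)).const_mul _

theorem averageEstimator_sub_mem_chaos (a : ℝ) :
    (fun x => averageEstimator A i K x - a) ∈ chaos i K m m := by
  have h : (fun x => averageEstimator A i K x - a) =
      (1 / (K : ℝ)) • (∑ k, ∑ j : Fin m → Fin d, entry A j i •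
        fun x : Fin K → Fin m → Fin d → ℝ => ∏ t, x k t i * x k t (j t)) - fun _ => a := by
    ext x
    simp [averageEstimator, diagEstimator_eq_sum]
  rw [h]
  exact Submodule.sub_mem _ (Submodule.smul_mem _ _ (Submodule.sum_mem _ fun k _ =>
    Submodule.sum_mem _ fun j _ => Submodule.smul_mem _ _ (prod_mul_mem_chaos i k j)))
    (const_mem_chaos i K m m a)

theorem hasAllMoments_averageEstimator :
    HasAllMoments (averageEstimator A i K) (sampleMeasure K m d) :=
  (HasAllMoments.finsetSum _ fun k _ => (hasAllMoments_diagEstimator A i).comp_measurePreserving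
    (measurePreserving_eval (fun _ => Measure.pi fun _ => stdGauss d) k)).const_mul _

theorem integral_averageEstimator (hK : K ≠ 0) :
    ∫ x, averageEstimator A i K x ∂sampleMeasure K m d = diagEntry A i := by
  have hmp := measurePreserving_eval (fun _ : Fin K => Measure.pi fun _ : Fin m => stdGauss d)
  have hk : ∀ k : Fin K, ∫ x, diagEstimator A (x k) i ∂sampleMeasure K m d = diagEntry A i := by
    intro k
    rw [← integral_diagEstimator A i, ← (hmp k).map_eq,
      integral_map (hmp k).aemeasurable
        (measurable_diagEstimator A i).stronglyMeasurable.aestronglyMeasurable]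
  simp only [averageEstimator]
  rw [integral_const_mul, integral_finsetSum _ fun k _ =>
    ((hasAllMoments_diagEstimator A i).comp_measurePreserving (hmp k)).integrable]
  simp only [hk]
  simp [hK]

theorem integral_averageEstimator_sub_sq (hK : K ≠ 0) :
    ∫ x, (averageEstimator A i K x - diagEntry A i) ^ 2 ∂sampleMeasure K m d =
      variance (fun x => diagEstimator A x i) (Measure.pi fun _ => stdGauss d) / K := by
  have hK' : (K : ℝ) ≠ 0 := by exact_mod_cast hK
  have h1 := variance_eq_integral (μ := sampleMeasure K m d) (X := averageEstimator A i K)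
    (measurable_averageEstimator A i K).aemeasurable
  rw [integral_averageEstimator A i K hK] at h1
  rw [← h1]
  have h2 : averageEstimator A i K = fun x => (1 / (K : ℝ)) *
      (∑ k, fun x : Fin K → Fin m → Fin d → ℝ => diagEstimator A (x k) i) x := by
    ext x; simp [averageEstimator]
  rw [h2, variance_const_mul, variance_sum_pi (X := fun _ x => diagEstimator A x i)
    fun _ => hasAllMoments_diagEstimator A i 2]
  simp
  field_simp

/-- Markov's inequality for even moments, together with hypercontractivity. -/
theorem one_sub_le_measureReal_averageEstimator {k : ℕ} {η M δ : ℝ} (hη : 0 < η)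
    (hmom : ∫ x, (averageEstimator A i K x - diagEntry A i) ^ (2 * k) ∂sampleMeasure K m d ≤
      M ^ k) (hM : M ^ k ≤ δ * (η ^ 2) ^ k) :
    1 - δ ≤ (sampleMeasure K m d).real
      {x | |averageEstimator A i K x - diagEntry A i| ≤ η} := by
  set f := fun x => averageEstimator A i K x - diagEntry A i with hf
  have hfm : HasAllMoments f (sampleMeasure K m d) :=
    (hasAllMoments_averageEstimator A i K).sub (HasAllMoments.const _)
  have hmarkov := mul_meas_ge_le_integral_of_nonneg (μ := sampleMeasure K m d)
    (f := fun x => f x ^ (2 * k))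
    (Filter.Eventually.of_forall fun x => (even_two_mul k).pow_nonneg _)
    (hfm.integrable_pow _) ((η ^ 2) ^ k)
  -- Either |f| ≤ η, or f^(2k) ≥ η^(2k); Markov's inequality bounds the second event.
  have hcover : (1 : ℝ) ≤ (sampleMeasure K m d).real {x | |f x| ≤ η} +
      (sampleMeasure K m d).real {x | (η ^ 2) ^ k ≤ f x ^ (2 * k)} := by
    rw [← probReal_univ (μ := sampleMeasure K m d)]
    refine (measureReal_mono fun x _ => ?_).trans (measureReal_union_le _ _)
    rcases le_or_gt |f x| η with h | h
    · exact Or.inl h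
    · refine Or.inr ?_
      simp only [Set.mem_ofPred_eq, pow_mul]
      refine pow_le_pow_left₀ (by positivity) ?_ k
      rw [← sq_abs (f x)]
      exact pow_le_pow_left₀ hη.le h.le 2
  have hpos : 0 < (η ^ 2) ^ k := by positivity
  have : (sampleMeasure K m d).real {x | (η ^ 2) ^ k ≤ f x ^ (2 * k)} ≤ δ := by
    refine le_of_mul_le_mul_left ?_ hpos
    calc _ ≤ _ := hmarkov
      _ ≤ M ^ k := hmom
      _ ≤ _ := by rw [mul_comm]; exact hM
  linarith

end Average

/-! ### Choice of the moment order and the tail bound -/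

/-- The choice of the moment: `16 k ≤ L` unless `k = 1`, while `32 k ≥ L - 2`. -/
theorem exists_moment_order {L : ℝ} :
    ∃ k : ℕ, k ≠ 0 ∧ L - 2 ≤ 32 * k ∧ (k = 1 ∨ 16 * (k : ℝ) ≤ L) := by
  rcases lt_or_ge L 16 with h | h
  · exact ⟨1, one_ne_zero, by norm_num; linarith, Or.inl rfl⟩
  · have h1 : (1 : ℝ) ≤ L / 16 := by linarith
    have hk : 1 ≤ ⌊L / 16⌋₊ := Nat.le_floor (by exact_mod_cast h1)
    have hk' : (1 : ℝ) ≤ ⌊L / 16⌋₊ := by exact_mod_cast hk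
    have h2 := Nat.floor_le (show 0 ≤ L / 16 by linarith)
    have h3 := Nat.lt_floor_add_one (L / 16)
    -- As the floor k is at least 1, L / 16 < k + 1 ≤ 2 k, which gives L ≤ 32 k.
    exact ⟨⌊L / 16⌋₊, by omega, by linarith, Or.inr (by linarith)⟩

theorem one_sub_le_measureReal_of_sample_size {m d : ℕ} (hm : 1 ≤ m) (A : Tensor (m + 1) d)
    (i : Fin d) (ha : diagEntry A i ≠ 0) {ε δ : ℝ} (hε : 0 < ε) (hδ : 0 < δ) (hδ1 : δ < 1) {K : ℕ}
    (hK : Real.exp 32 * (varBound A i * (2 + Real.log (1 / δ)) ^ (2 * m) /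
      (ε ^ 2 * diagEntry A i ^ 2)) ≤ K) :
    1 - δ ≤ (sampleMeasure K m d).real
      {x | |averageEstimator A i K x - diagEntry A i| ≤ ε * |diagEntry A i|} := by
  set L := 2 + Real.log (1 / δ) with hL
  set a := diagEntry A i with haDef
  have hV := varBound_pos hm A i ha
  have hlog : 0 < Real.log (1 / δ) := Real.log_pos (by rw [lt_div_iff₀ hδ]; linarith)
  have hL0 : 0 < L := by linarith
  have hη : 0 < ε * |a| := mul_pos hε (abs_pos.2 ha)
  have hη2 : (ε * |a|) ^ 2 = ε ^ 2 * a ^ 2 := by rw [mul_pow, sq_abs]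
  have hden : 0 < ε ^ 2 * a ^ 2 := hη2 ▸ pow_pos hη 2
  have hKpos : (0 : ℝ) < K := lt_of_lt_of_le (by positivity) hK
  have hK0 : K ≠ 0 := by rintro rfl; simp at hKpos
  obtain ⟨k, hk0, hk1, hk2⟩ := exists_moment_order (L := L)
  set S := ∫ x, (averageEstimator A i K x - a) ^ 2 ∂sampleMeasure K m d with hS
  have hS0 : 0 ≤ S := integral_nonneg fun x => sq_nonneg _
  have hSV : S ≤ varBound A i / K := by
    rw [hS, integral_averageEstimator_sub_sq A i K hK0]
    gcongr
    rw [variance_diagEstimator]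
    exact sum_pow_mul_levelSq_sub_le_varBound A i
  have hmom : ∫ x, (averageEstimator A i K x - a) ^ (2 * k) ∂sampleMeasure K m d ≤
      (L ^ (2 * m) * S) ^ k := by
    -- For k = 1 the bound is trivial because L ≥ 1. Otherwise 16 k ≤ L turns the hypercontractive
    -- constant 256 k² into at most L².
    rcases hk2 with rfl | hk2
    · have hL1 : 1 ≤ L ^ (2 * m) := one_le_pow₀ (by linarith)
      simpa using le_mul_of_one_le_left hS0 hL1
    · refine (integral_pow_le_of_mem_chaos (averageEstimator_sub_mem_chaos A i K a) hk0).trans ?_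
      have h256 : 256 * (k : ℝ) ^ 2 ≤ L ^ 2 := by
        have := pow_le_pow_left₀ (by positivity) hk2 2
        linarith [mul_pow 16 (k : ℝ) 2]
      rw [pow_mul L 2 m]
      gcongr
  refine one_sub_le_measureReal_averageEstimator A i K hη hmom ?_
  -- Raised to the power k, the factor e^(-32) becomes e^(-32 k) ≤ e^(-(L - 2)) = δ. This fixes the
  -- constant e^32 in the sample size.
  have hLS : L ^ (2 * m) * S ≤ Real.exp (-32) * (ε * |a|) ^ 2 := by
    have h1 : Real.exp 32 * (varBound A i * L ^ (2 * m)) ≤ K * (ε ^ 2 * a ^ 2) := by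
      rwa [← mul_div_assoc, div_le_iff₀ hden] at hK
    calc L ^ (2 * m) * S ≤ L ^ (2 * m) * (varBound A i / K) := by gcongr
      _ = Real.exp (-32) * (Real.exp 32 * (varBound A i * L ^ (2 * m))) / K := by
          rw [← mul_assoc, ← Real.exp_add]
          simp
          ring
      _ ≤ Real.exp (-32) * (K * (ε ^ 2 * a ^ 2)) / K := by gcongr
      _ = _ := by rw [hη2]; field_simp
  calc (L ^ (2 * m) * S) ^ k ≤ (Real.exp (-32) * (ε * |a|) ^ 2) ^ k := by gcongr
    _ = Real.exp (-(32 * k)) * ((ε * |a|) ^ 2) ^ k := by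
        rw [mul_pow, ← Real.exp_nat_mul]
        congr 2
        ring
    _ ≤ δ * ((ε * |a|) ^ 2) ^ k := by
        gcongr
        rw [← Real.le_log_iff_exp_le hδ]
        have : Real.log (1 / δ) = -Real.log δ := by rw [one_div, Real.log_inv]
        linarith

end TensorDiag

/-! ### The main theorem, transferred to an arbitrary probability space -/

theorem mainTheorem4 :
    (∀ (m d : ℕ), 1 ≤ m → ∀ (A : TensorDiag.Tensor (m + 1) d)
      (Ω : Type*) [MeasurableSpace Ω] (μ : Measure Ω) [IsProbabilityMeasure μ]
      (g : Fin m → Fin d → Ω → ℝ),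
      TensorDiag.IsIIDStdNormal (fun x : Fin m × Fin d => g x.1 x.2) μ →
      ∀ i : Fin d,
        MemLp (fun ω => TensorDiag.diagEstimator A (fun t j => g t j ω) i) 2 μ ∧
        variance (fun ω => TensorDiag.diagEstimator A (fun t j => g t j ω) i) μ =
          (∑ s ∈ Finset.range (m + 1), (3 : ℝ) ^ s * TensorDiag.levelSq A i s)
            - TensorDiag.diagEntry A i ^ 2 ∧
        (∑ s ∈ Finset.range (m + 1), (3 : ℝ) ^ s * TensorDiag.levelSq A i s)
            - TensorDiag.diagEntry A i ^ 2 ≤ TensorDiag.varBound A i) ∧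
    (∃ C : ℝ, 0 < C ∧
      ∀ (m d : ℕ), 1 ≤ m → ∀ (A : TensorDiag.Tensor (m + 1) d) (i : Fin d),
      TensorDiag.diagEntry A i ≠ 0 →
      ∀ (ε δ : ℝ), 0 < ε → 0 < δ → δ < 1 →
      ∀ (K : ℕ), C * (TensorDiag.varBound A i * (2 + Real.log (1 / δ)) ^ (2 * m) /
          (ε ^ 2 * TensorDiag.diagEntry A i ^ 2)) ≤ (K : ℝ) →
      ∀ (Ω : Type*) [MeasurableSpace Ω] (μ : Measure Ω) [IsProbabilityMeasure μ]
        (g : Fin K → Fin m → Fin d → Ω → ℝ),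
        TensorDiag.IsIIDStdNormal
          (fun x : Fin K × Fin m × Fin d => g x.1 x.2.1 x.2.2) μ →
        TensorDiag.IsApproximation
          (fun ω => (1 / (K : ℝ)) *
            ∑ k : Fin K, TensorDiag.diagEstimator A (fun t j => g k t j ω) i)
          μ ε δ (TensorDiag.diagEntry A i)) := by
  refine ⟨fun m d _ A Ω _ μ _ g hg i => ?_, Real.exp 32, Real.exp_pos _,
    fun m d hm A i ha ε δ hε hδ hδ1 K hK Ω _ μ _ g hg => ?_⟩
  · have hlaw := hg.hasLaw_pi_stdGauss
    have hmeas := TensorDiag.measurable_diagEstimator A i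
    refine ⟨?_, ?_, TensorDiag.sum_pow_mul_levelSq_sub_le_varBound A i⟩
    · have h := TensorDiag.hasAllMoments_diagEstimator A i 2
      rw [← hlaw.map_eq, memLp_map_measure_iff hmeas.stronglyMeasurable.aestronglyMeasurable
        hlaw.aemeasurable] at h
      exact h
    · rw [← TensorDiag.variance_diagEstimator A i, ← hlaw.map_eq,
        variance_map hmeas.aemeasurable hlaw.aemeasurable]
      rfl
  · have hlaw := hg.hasLaw_pi_pi_stdGauss
    have h := TensorDiag.one_sub_le_measureReal_of_sample_size hm A i ha hε hδ hδ1 hK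
    have hmeas := TensorDiag.measurable_averageEstimator A i K
    rw [← hlaw.measureReal_eq (measurableSet_le (by fun_prop) (by fun_prop))] at h
    exact h
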